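/- For a permutation $\sigma=\sigma_1\cdots\sigma_N$ of $\{1,\dots,N\}$ put $\sigma_0=\sigma_{N+1}=0$. For $1\le i\le N$ the letter $\sigma_i$ is a peak if $\sigma_{i-1}<\sigma_i>\sigma_{i+1}$ and a double descent if $\sigma_{i-1}>\sigma_i>\sigma_{i+1}$. A descent is a pair $(\sigma_i,\sigma_{i+1})$ with $1\le i\le N-1$ and $\sigma_i>\sigma_{i+1}$. Let $\mathrm{des}\,\sigma$ and $\mathrm{dd}\,\sigma$ be the numbers of descents and of double descents of $\sigma$; let $\mathrm{lema}\,\sigma$ be the number of even letters $\sigma_i$ such that $\sigma_j<\sigma_i$ for all $1\le j<i$; let $\mathrm{les}\,\sigma$ be the number of pairs $(i,j)$ with $2\le i<j\le N$ and $\sigma_{i-1}>\sigma_j>\sigma_i$; and let $\mathrm{res}\,\sigma$ be the number of pairs $(i,j)$ with $1\le i<j\le N-1$ and $\sigma_{j+1}>\sigma_i>\sigma_j$. For $n\ge 0$ let $\mathcal{Y}^*_{2n+1}$ be the set of permutations of $\{1,\dots,2n+1\}$ whose last letter is odd and in which $\sigma_i$ and $\sigma_{i+1}$ are both odd for every descent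 $(\sigma_i,\sigma_{i+1})$, and let $$Y_n(a,p,q,y,t)=\sum_{\sigma\in\mathcal{Y}^*_{2n+1}}a^{\mathrm{lema}\,\sigma}p^{\mathrm{res}\,\sigma}q^{\mathrm{les}\,\sigma}y^{\mathrm{dd}\,\sigma}t^{\mathrm{des}\,\sigma}.$$ Let $\overline{\mathcal{Y}}^*_{2n+1,k}$ be the set of those $\sigma\in\mathcal{Y}^*_{2n+1}$ with exactly $k$ descents that have no double descent and whose last letter is a peak ($\mathcal{F}$-permutations with $k$ descents). **Theorem.** For every integer $n\ge 0$, $$Y_n(a,p,q,y,t)=\sum_{k=0}^{\lfloor n/2\rfloor}\gamma_{n,k}(a,p,q)\,t^k(1+yt)^{n-2k},\qquad \gamma_{n,k}(a,p,q)=\sum_{\sigma\in\overline{\mathcal{Y}}^*_{2n+1,k}}a^{\mathrm{lema}\,\sigma}p^{\mathrm{res}\,\sigma}q^{\mathrm{les}\,\sigma},$$ as an identity of polynomials; that is, it holds for all elements $a,p,q,y,t$ of every commutative ring. -/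

import Mathlib

namespace OddOdd

open Finset

/-- The word of a permutation of `{1, …, N}` with boundary zeros: for `1 ≤ i ≤ N` this is the
`i`-th letter `σ_i ∈ {1, …, N}` (the element `x : Fin N` stands for the number `x + 1`),
and `σ_0 = σ_{N+1} = 0`. -/
def letter {N : ℕ} (σ : Equiv.Perm (Fin N)) (i : ℕ) : ℕ :=
  if h : 1 ≤ i ∧ i ≤ N then (σ ⟨i - 1, by omega⟩ : ℕ) + 1 else 0

/-- `(σ_i, σ_{i+1})` is a descent; used for `1 ≤ i ≤ N - 1`. -/
abbrev IsDescent {N : ℕ} (σ : Equiv.Perm (Fin N)) (i : ℕ) : Prop :=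
  letter σ i > letter σ (i + 1)

/-- `σ_i` is a peak (with `σ_0 = σ_{N+1} = 0`); used for `1 ≤ i ≤ N`. -/
abbrev IsPeak {N : ℕ} (σ : Equiv.Perm (Fin N)) (i : ℕ) : Prop :=
  letter σ (i - 1) < letter σ i ∧ letter σ i > letter σ (i + 1)

/-- `σ_i` is a double descent (with `σ_0 = σ_{N+1} = 0`); used for `1 ≤ i ≤ N`. -/
abbrev IsDoubleDescent {N : ℕ} (σ : Equiv.Perm (Fin N)) (i : ℕ) : Prop :=
  letter σ (i - 1) > letter σ i ∧ letter σ i > letter σ (i + 1)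

/-- `σ_i` is a left-to-right maximum; used for `1 ≤ i ≤ N`. -/
abbrev IsLeftToRightMax {N : ℕ} (σ : Equiv.Perm (Fin N)) (i : ℕ) : Prop :=
  ∀ j ∈ Ico 1 i, letter σ j < letter σ i

/-- The number of descents. -/
def des {N : ℕ} (σ : Equiv.Perm (Fin N)) : ℕ :=
  #{i ∈ Ico 1 N | IsDescent σ i}

/-- The number of double descents. -/
def dd {N : ℕ} (σ : Equiv.Perm (Fin N)) : ℕ :=
  #{i ∈ Icc 1 N | IsDoubleDescent σ i}

/-- The number of even left-to-right maxima. -/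
def lema {N : ℕ} (σ : Equiv.Perm (Fin N)) : ℕ :=
  #{i ∈ Icc 1 N | IsLeftToRightMax σ i ∧ Even (letter σ i)}

/-- The number of pairs `(i, j)` with `2 ≤ i < j ≤ N` and `σ_{i-1} > σ_j > σ_i`. -/
def les {N : ℕ} (σ : Equiv.Perm (Fin N)) : ℕ :=
  #{x ∈ Icc 2 N ×ˢ Icc 2 N | x.1 < x.2 ∧
    letter σ (x.1 - 1) > letter σ x.2 ∧ letter σ x.2 > letter σ x.1}

/-- The number of pairs `(i, j)` with `1 ≤ i < j ≤ N - 1` and `σ_{j+1} > σ_i > σ_j`. -/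
def res {N : ℕ} (σ : Equiv.Perm (Fin N)) : ℕ :=
  #{x ∈ Ico 1 N ×ˢ Ico 1 N | x.1 < x.2 ∧
    letter σ (x.2 + 1) > letter σ x.1 ∧ letter σ x.1 > letter σ x.2}

/-- `𝒴*_{2n+1}`: the permutations of `{1, …, 2n+1}` all of whose descents are odd-odd
(top and bottom are both odd) and whose last letter is odd. -/
def Ystar (n : ℕ) : Finset (Equiv.Perm (Fin (2 * n + 1))) :=
  {σ | (∀ i ∈ Ico 1 (2 * n + 1), IsDescent σ i → Odd (letter σ i) ∧ Odd (letter σ (i + 1))) ∧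
    Odd (letter σ (2 * n + 1))}

/-- The `𝓕`-permutations: the elements of `𝒴*_{2n+1}` that contain no double descent and whose
last letter is a peak. -/
def FPerm (n : ℕ) : Finset (Equiv.Perm (Fin (2 * n + 1))) :=
  {σ ∈ Ystar n | (∀ i ∈ Icc 1 (2 * n + 1), ¬ IsDoubleDescent σ i) ∧ IsPeak σ (2 * n + 1)}

/-- The `𝓕`-permutations with `k` descents. -/
def FPermDes (n k : ℕ) : Finset (Equiv.Perm (Fin (2 * n + 1))) :=
  {σ ∈ FPerm n | des σ = k}

/-- The enumerative polynomial `Y_n(a,p,q,y,t)`. -/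
def Y {R : Type*} [CommRing R] (n : ℕ) (a p q y t : R) : R :=
  ∑ σ ∈ Ystar n, a ^ lema σ * p ^ res σ * q ^ les σ * y ^ dd σ * t ^ des σ

/-- The polynomial `γ_{n,k}(a,p,q)`, enumerating the `𝓕`-permutations with `k` descents. -/
def gammaCoeff {R : Type*} [CommRing R] (n k : ℕ) (a p q : R) : R :=
  ∑ σ ∈ FPermDes n k, a ^ lema σ * p ^ res σ * q ^ les σ

end OddOdd

/-! The proof is valley hopping, a modified Foata–Strehl action. A letter `x` that is a double
ascent hops over the maximal block of larger letters following it and becomes a double descent; the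
inverse hop goes left. Every other letter keeps its comparisons with both neighbours. Steps that
cross the level of another letter only gain or lose an intermediate point, which is why `les` and
`res` are invariant (`Hop.les_eq`, `Hop.res_eq`). For odd `x`, `lema` and membership in `Ystar` are
invariant too.

In `Ystar` every even letter is a double ascent (`mem_Ystar_iff`), so only odd letters can be double
descents. Each descent bottom is a valley or a double descent, hence `y ^ dd * t ^ des` is `t` to
the number of valleys times one factor `y * t` per double descent. One letter at a time, a double
descent worth `y * t` is merged with its hop partner worth `1`, giving `1 + y * t` on the partner
(`sum_YstarAvoid_insert`). After all letters only words without double descents remain, with one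
factor `1 + y * t` per odd double ascent. Counting the `n + 1` odd letters by type shows that there
are `n - 2 * des σ` of these (`two_mul_des_add_card`). -/

namespace OddOdd

open Finset

/-! ### Words with boundary zeros and positions of letters -/

section Words

variable {N : ℕ} {σ σ' τ τ' : Equiv.Perm (Fin N)} {x v w : Fin N} {i j i' j' : ℕ}

/-- The position of the letter `v + 1` in the word of `σ`. -/
def pos (σ : Equiv.Perm (Fin N)) (v : Fin N) : ℕ := (σ.symm v : ℕ) + 1

lemma letter_zero (σ : Equiv.Perm (Fin N)) : letter σ 0 = 0 := by simp [letter]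

lemma letter_of_lt {k : ℕ} (h : N < k) : letter σ k = 0 := by
  simp [letter]; omega

lemma one_le_pos (σ : Equiv.Perm (Fin N)) (v : Fin N) : 1 ≤ pos σ v := by simp [pos]

lemma pos_le (σ : Equiv.Perm (Fin N)) (v : Fin N) : pos σ v ≤ N := by
  have := (σ.symm v).2
  simp only [pos]; omega

lemma letter_pos (σ : Equiv.Perm (Fin N)) (v : Fin N) : letter σ (pos σ v) = v + 1 := by
  have := (σ.symm v).2
  simp [letter, pos]

lemma exists_pos_eq (σ : Equiv.Perm (Fin N)) {k : ℕ} (h1 : 1 ≤ k) (h2 : k ≤ N) :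
    ∃ v, pos σ v = k := by
  refine ⟨σ ⟨k - 1, by omega⟩, ?_⟩
  simp [pos]; omega

lemma pos_injective (σ : Equiv.Perm (Fin N)) : Function.Injective (pos σ) := by
  intro v w h
  simp only [pos, add_left_inj] at h
  exact σ.symm.injective (Fin.ext h)

lemma eq_pos_of_letter_eq {k : ℕ} (h : letter σ k = v + 1) : k = pos σ v := by
  by_cases hk : 1 ≤ k ∧ k ≤ N
  · obtain ⟨w, rfl⟩ := exists_pos_eq σ hk.1 hk.2
    rw [letter_pos] at h
    rw [Fin.ext (Nat.succ_injective h) (a := w)]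
  · simp [letter, hk] at h

lemma perm_ext_of_letter (h : ∀ k, letter σ k = letter τ k) : σ = τ := by
  ext a
  have h1 := h (a + 1)
  have ha : 1 ≤ (a : ℕ) + 1 ∧ (a : ℕ) + 1 ≤ N := ⟨by omega, a.2⟩
  simpa [letter, ha] using h1

lemma letter_pred_pos_ne (σ : Equiv.Perm (Fin N)) (v : Fin N) :
    letter σ (pos σ v - 1) ≠ v + 1 := fun h => by
  have := eq_pos_of_letter_eq h
  have := one_le_pos σ v
  omega

/-! ### Hops as rotations of positions -/

/-- The rotation of the positions `i, …, j`. -/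
def rotate (i j k : ℕ) : ℕ := if k < i ∨ j < k then k else if k = j then i else k + 1

/-- The inverse rotation of the positions `i, …, j`. -/
def unrotate (i j k : ℕ) : ℕ := if k < i ∨ j < k then k else if k = i then j else k - 1

lemma rotate_unrotate (h : i < j) (k : ℕ) : rotate i j (unrotate i j k) = k := by
  unfold rotate unrotate; split_ifs <;> omega

lemma unrotate_rotate (h : i < j) (k : ℕ) : unrotate i j (rotate i j k) = k := by
  unfold rotate unrotate; split_ifs <;> omega

/-- `τ` arises from `σ` by moving the letter `x + 1` from position `i` to position `j`, past a
maximal block of larger letters that follows it. -/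
structure Hop (x : Fin N) (σ τ : Equiv.Perm (Fin N)) (i j : ℕ) : Prop where
  one_le : 1 ≤ i
  lt : i < j
  le : j ≤ N
  start : letter σ i = x + 1
  above : ∀ k, i < k → k ≤ j → (x : ℕ) + 1 < letter σ k
  left : letter σ (i - 1) < x + 1
  right : letter σ (j + 1) < x + 1
  eq : ∀ k, letter τ k = letter σ (rotate i j k)

/-- The permutation of `Fin N` given by the rotation of the positions `i, …, j`. -/
def rotatePerm (N i j : ℕ) (hi : 1 ≤ i) (h : i < j) (hj : j ≤ N) : Equiv.Perm (Fin N) where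
  toFun a := ⟨rotate i j (a + 1) - 1, by unfold rotate; split_ifs <;> omega⟩
  invFun a := ⟨unrotate i j (a + 1) - 1, by unfold unrotate; split_ifs <;> omega⟩
  left_inv a := by
    ext
    simp only [rotate, unrotate]
    split_ifs <;> omega
  right_inv a := by
    ext
    simp only [rotate, unrotate]
    split_ifs <;> omega

lemma letter_mul_rotatePerm (σ : Equiv.Perm (Fin N)) (hi : 1 ≤ i) (h : i < j) (hj : j ≤ N)
    (k : ℕ) : letter (σ * rotatePerm N i j hi h hj) k = letter σ (rotate i j k) := by
  by_cases hk : 1 ≤ k ∧ k ≤ N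
  · have h2 : 1 ≤ rotate i j k ∧ rotate i j k ≤ N := by
      unfold rotate; split_ifs <;> omega
    have h3 : k - 1 + 1 = k := by omega
    simp [letter, hk, h2, rotatePerm, h3]
  · have h2 : ¬ (1 ≤ rotate i j k ∧ rotate i j k ≤ N) := by
      unfold rotate; split_ifs <;> omega
    simp only [letter, hk, h2, dif_neg, not_false_eq_true]

lemma letter_rotatePerm_symm (σ : Equiv.Perm (Fin N)) (hi : 1 ≤ i) (h : i < j) (hj : j ≤ N)
    (k : ℕ) : letter (σ * (rotatePerm N i j hi h hj)⁻¹) k = letter σ (unrotate i j k) := by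
  have := letter_mul_rotatePerm (σ * (rotatePerm N i j hi h hj)⁻¹) hi h hj (unrotate i j k)
  rw [rotate_unrotate h] at this
  simpa using this.symm

/-- A maximal block of letters that are larger than `v + 1` follows each letter `v + 1`. -/
lemma exists_right_end (σ : Equiv.Perm (Fin N)) (v : Fin N) :
    ∃ j, pos σ v ≤ j ∧ j ≤ N ∧ (∀ k, pos σ v < k → k ≤ j → (v : ℕ) + 1 < letter σ k) ∧
      letter σ (j + 1) < v + 1 := by
  have hex : ∃ d, letter σ (pos σ v + d + 1) < v + 1 :=
    ⟨N, by rw [letter_of_lt (by omega)]; omega⟩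
  classical
  refine ⟨pos σ v + Nat.find hex, by omega, ?_, ?_, Nat.find_spec hex⟩
  · have := pos_le σ v
    have : Nat.find hex ≤ N - pos σ v :=
      Nat.find_min' hex (by rw [letter_of_lt (by omega)]; omega)
    omega
  · intro k hk hk'
    have := Nat.find_min hex (m := k - pos σ v - 1) (by omega)
    rw [show pos σ v + (k - pos σ v - 1) + 1 = k by omega] at this
    have hne : letter σ k ≠ v + 1 := fun h => by
      have := eq_pos_of_letter_eq h; omega
    omega

/-- A maximal block of letters that are larger than `v + 1` precedes each letter `v + 1`. -/
lemma exists_left_end (σ : Equiv.Perm (Fin N)) (v : Fin N) :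
    ∃ i, 1 ≤ i ∧ i ≤ pos σ v ∧ (∀ k, i ≤ k → k < pos σ v → (v : ℕ) + 1 < letter σ k) ∧
      letter σ (i - 1) < v + 1 := by
  -- Truncated subtraction makes every far enough position equal to 0, where the boundary zero stops
  -- the search.
  have hex : ∃ d, letter σ (pos σ v - d - 1) < v + 1 :=
    ⟨N, by
      have := pos_le σ v
      rw [show pos σ v - N - 1 = 0 by omega, letter_zero]; omega⟩
  classical
  have h1 := one_le_pos σ v
  have hle : Nat.find hex ≤ pos σ v - 1 :=
    Nat.find_min' hex (by
      rw [show pos σ v - (pos σ v - 1) - 1 = 0 by omega, letter_zero]; omega)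
  refine ⟨pos σ v - Nat.find hex, by omega, by omega, ?_, Nat.find_spec hex⟩
  intro k hk hk'
  have := Nat.find_min hex (m := pos σ v - k - 1) (by omega)
  rw [show pos σ v - (pos σ v - k - 1) - 1 = k by omega] at this
  have hne : letter σ k ≠ v + 1 := fun h => by
    have := eq_pos_of_letter_eq h; omega
  omega

/-- The predecessor of the letter `v + 1` is smaller. -/
abbrev RisesTo (σ : Equiv.Perm (Fin N)) (v : Fin N) : Prop := letter σ (pos σ v - 1) < v + 1

/-- The successor of the letter `v + 1` is smaller. -/
abbrev FallsFrom (σ : Equiv.Perm (Fin N)) (v : Fin N) : Prop := letter σ (pos σ v + 1) < v + 1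

lemma exists_hop_of_doubleAscent (h1 : RisesTo σ x) (h2 : ¬ FallsFrom σ x) :
    ∃ τ i j, Hop x σ τ i j := by
  obtain ⟨j, hj1, hj2, hj3, hj4⟩ := exists_right_end σ x
  have hlt : pos σ x < j := by
    rcases hj1.lt_or_eq with h | h
    · exact h
    · rw [← h] at hj4; exact absurd hj4 h2
  exact ⟨_, pos σ x, j, one_le_pos σ x, hlt, hj2, letter_pos σ x, hj3, h1, hj4,
    letter_mul_rotatePerm σ (one_le_pos σ x) hlt hj2⟩

lemma exists_hop_of_doubleDescent (h1 : ¬ RisesTo τ x) (h2 : FallsFrom τ x) :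
    ∃ σ i j, Hop x σ τ i j := by
  obtain ⟨i, hi1, hi2, hi3, hi4⟩ := exists_left_end τ x
  have hlt : i < pos τ x := by
    rcases hi2.lt_or_eq with h | h
    · exact h
    · rw [h] at hi4; exact absurd hi4 h1
  have key := letter_rotatePerm_symm τ hi1 hlt (pos_le τ x)
  refine ⟨τ * (rotatePerm N i (pos τ x) hi1 hlt (pos_le τ x))⁻¹, i, pos τ x, hi1, hlt, pos_le τ x, ?_, ?_, ?_, ?_, fun k => ?_⟩
  · rw [key, unrotate, if_neg (by omega), if_pos rfl, letter_pos]
  · intro k hk hk'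
    rw [key, unrotate, if_neg (by omega), if_neg (by omega)]
    exact hi3 _ (by omega) (by omega)
  · rw [key, unrotate, if_pos (by omega)]; exact hi4
  · rw [key, unrotate, if_pos (by omega)]; exact h2
  · rw [key, unrotate_rotate hlt]

namespace Hop

lemma pos_source (h : Hop x σ τ i j) : pos σ x = i := (eq_pos_of_letter_eq h.start).symm

lemma pos_target (h : Hop x σ τ i j) (v : Fin N) : pos τ v = unrotate i j (pos σ v) := by
  symm
  apply eq_pos_of_letter_eq
  rw [h.eq, rotate_unrotate h.lt, letter_pos]

end Hop

/-! ### Effect of a hop on neighbours and on step sums -/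

/-- The sum of the weights `e` of the first `k` steps of a word with boundary zeros. -/
def stepSum (e : ℕ → ℕ → ℕ) (σ : Equiv.Perm (Fin N)) (k : ℕ) : ℕ :=
  ∑ m ∈ range k, e (letter σ m) (letter σ (m + 1))

lemma stepSum_succ (e : ℕ → ℕ → ℕ) (σ : Equiv.Perm (Fin N)) (k : ℕ) :
    stepSum e σ (k + 1) = stepSum e σ k + e (letter σ k) (letter σ (k + 1)) :=
  sum_range_succ _ _

namespace Hop

lemma letter_of_lt (h : Hop x σ τ i j) {k : ℕ} (hk : k < i) : letter τ k = letter σ k := by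
  rw [h.eq, rotate, if_pos (Or.inl hk)]

lemma letter_of_gt (h : Hop x σ τ i j) {k : ℕ} (hk : j < k) : letter τ k = letter σ k := by
  rw [h.eq, rotate, if_pos (Or.inr hk)]

lemma letter_of_mem (h : Hop x σ τ i j) {k : ℕ} (hk : i ≤ k) (hk' : k < j) :
    letter τ k = letter σ (k + 1) := by
  rw [h.eq, rotate, if_neg (by omega), if_neg (by omega)]

lemma letter_end (h : Hop x σ τ i j) : letter τ j = x + 1 := by
  have := h.lt
  rw [h.eq, rotate, if_neg (by omega), if_pos rfl, h.start]

lemma pos_end (h : Hop x σ τ i j) : pos τ x = j := (eq_pos_of_letter_eq h.letter_end).symm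

lemma pos_of_lt (h : Hop x σ τ i j) (hv : pos σ v < i) : pos τ v = pos σ v := by
  rw [h.pos_target, unrotate, if_pos (Or.inl hv)]

lemma pos_of_gt (h : Hop x σ τ i j) (hv : j < pos σ v) : pos τ v = pos σ v := by
  rw [h.pos_target, unrotate, if_pos (Or.inr hv)]

lemma pos_of_mem (h : Hop x σ τ i j) (hv : i < pos σ v) (hv' : pos σ v ≤ j) :
    pos τ v = pos σ v - 1 := by
  rw [h.pos_target, unrotate, if_neg (by omega), if_neg (by omega)]

lemma target_above (h : Hop x σ τ i j) {k : ℕ} (hk : i ≤ k) (hk' : k < j) :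
    (x : ℕ) + 1 < letter τ k := by
  rw [h.letter_of_mem hk hk']; exact h.above _ (by omega) (by omega)

lemma target_left (h : Hop x σ τ i j) : letter τ (i - 1) < x + 1 := by
  have := h.one_le
  rw [h.letter_of_lt (by omega)]; exact h.left

lemma target_right (h : Hop x σ τ i j) : letter τ (j + 1) < x + 1 := by
  rw [h.letter_of_gt (by omega)]; exact h.right

lemma pos_ne (h : Hop x σ τ i j) (hv : v ≠ x) : pos σ v ≠ i := fun hi =>
  hv (pos_injective σ (hi.trans h.pos_source.symm))

lemma risesTo_source (h : Hop x σ τ i j) : RisesTo σ x := by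
  have := h.left
  rwa [RisesTo, h.pos_source]

lemma not_fallsFrom_source (h : Hop x σ τ i j) : ¬ FallsFrom σ x := by
  have := h.above (i + 1) (by omega) h.lt
  rw [FallsFrom, h.pos_source]
  omega

lemma not_risesTo_target (h : Hop x σ τ i j) : ¬ RisesTo τ x := by
  have := h.lt
  have := h.target_above (k := j - 1) (by omega) (by omega)
  rw [RisesTo, h.pos_end]
  omega

lemma fallsFrom_target (h : Hop x σ τ i j) : FallsFrom τ x := by
  have := h.target_right
  rwa [FallsFrom, h.pos_end]

/-- Hopping preserves the comparison of each other letter with its predecessor. -/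
lemma risesTo_iff (h : Hop x σ τ i j) (hv : v ≠ x) : RisesTo τ v ↔ RisesTo σ v := by
  have hne := h.pos_ne hv
  have h1 := h.one_le
  have h2 := h.lt
  have hp := letter_pos σ v
  have hp1 := one_le_pos σ v
  unfold RisesTo
  rcases lt_or_gt_of_ne hne with hlt | hgt
  · rw [h.pos_of_lt hlt, h.letter_of_lt (by omega)]
  · rcases le_or_gt (pos σ v) j with hle | hj
    · rw [h.pos_of_mem hgt hle]
      have hx := h.above _ hgt hle
      by_cases he : pos σ v = i + 1
      · have hl := h.left
        have hs := h.start
        rw [he] at hx hp ⊢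
        rw [h.letter_of_lt (by omega)]
        simp only [Nat.add_sub_cancel, hs]
        omega
      · rw [h.letter_of_mem (by omega) (by omega),
          show pos σ v - 1 - 1 + 1 = pos σ v - 1 by omega]
    · rw [h.pos_of_gt hj]
      by_cases he : pos σ v = j + 1
      · have hr := h.right
        have ha := h.above j h2 le_rfl
        rw [he] at hp ⊢
        simp only [Nat.add_sub_cancel, h.letter_end]
        omega
      · rw [h.letter_of_gt (by omega)]

/-- Hopping preserves the comparison of each other letter with its successor. -/
lemma fallsFrom_iff (h : Hop x σ τ i j) (hv : v ≠ x) : FallsFrom τ v ↔ FallsFrom σ v := by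
  have hne := h.pos_ne hv
  have h1 := h.one_le
  have h2 := h.lt
  have hp := letter_pos σ v
  have hp1 := one_le_pos σ v
  unfold FallsFrom
  rcases lt_or_gt_of_ne hne with hlt | hgt
  · rw [h.pos_of_lt hlt]
    by_cases he : pos σ v + 1 = i
    · have hl := h.left
      have hx := h.above (i + 1) (by omega) h.lt
      rw [show i - 1 = pos σ v by omega] at hl
      rw [he, h.letter_of_mem le_rfl h2, h.start]
      omega
    · rw [h.letter_of_lt (by omega)]
  · rcases le_or_gt (pos σ v) j with hle | hj
    · rw [h.pos_of_mem hgt hle, Nat.sub_add_cancel hp1]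
      have hx := h.above _ hgt hle
      rcases hle.lt_or_eq with hlt | heq
      · rw [h.letter_of_mem hgt.le hlt]
      · have hr := h.right
        rw [heq, h.letter_end]
        omega
    · rw [h.pos_of_gt hj, h.letter_of_gt (by omega)]

/-- Hopping preserves each step sum whose weight is additive along monotone detours via `x`. -/
lemma stepSum_eq (h : Hop x σ τ i j) {e : ℕ → ℕ → ℕ}
    (he1 : ∀ b c, b < (x : ℕ) + 1 → (x : ℕ) + 1 < c → e b (x + 1) + e (x + 1) c = e b c)
    (he2 : ∀ b c, b < (x : ℕ) + 1 → (x : ℕ) + 1 < c → e c (x + 1) + e (x + 1) b = e c b) :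
    (∀ k < i, stepSum e τ k = stepSum e σ k) ∧
    (∀ k, i ≤ k → k < j → stepSum e τ k = stepSum e σ (k + 1)) ∧
    (∀ k, j < k → stepSum e τ k = stepSum e σ k) := by
  obtain ⟨i, rfl⟩ : ∃ i', i = i' + 1 := ⟨i - 1, by have := h.one_le; omega⟩
  have h2 := h.lt
  have first : ∀ k < i + 1, stepSum e τ k = stepSum e σ k := fun k hk =>
    sum_congr rfl fun m hm => by
      have := mem_range.1 hm
      rw [h.letter_of_lt (by omega), h.letter_of_lt (by omega)]
  have second : ∀ k, i + 1 ≤ k → k < j → stepSum e τ k = stepSum e σ (k + 1) := by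
    intro k hk
    induction k, hk using Nat.le_induction with
    | base =>
      intro hj
      have hl : letter σ i < x + 1 := h.left
      -- Taking `x` out replaces the two rising steps through it by one direct step.
      have := he1 _ _ hl (h.above (i + 1 + 1) (by omega) (by omega))
      rw [stepSum_succ, stepSum_succ, stepSum_succ, first i (by omega), h.letter_of_lt (by omega),
        h.letter_of_mem le_rfl hj, h.start]
      omega
    | succ k hk ih =>
      intro hj
      rw [stepSum_succ, stepSum_succ _ _ (k + 1), ih (by omega), h.letter_of_mem hk (by omega),
        h.letter_of_mem (by omega) hj]
  refine ⟨first, second, fun k hk => ?_⟩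
  induction k, Nat.succ_le_of_lt hk using Nat.le_induction with
  | base =>
    obtain ⟨j, rfl⟩ : ∃ j', j = j' + 1 := ⟨j - 1, by omega⟩
    -- Putting `x` back after the block splits the falling step that leaves the block, so the
    -- indices agree again.
    have := he2 _ _ h.right (h.above (j + 1) (by omega) (by omega))
    rw [stepSum_succ, stepSum_succ, second j (by omega) (by omega),
      h.letter_of_mem (by omega) (by omega), h.letter_end, h.letter_of_gt (by omega),
      stepSum_succ _ _ (j + 1)]
    omega
  | succ k hk ih =>
    rw [stepSum_succ, stepSum_succ, ih (by omega), h.letter_of_gt (by omega),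
      h.letter_of_gt (by omega)]

lemma stepSum_pos_eq (h : Hop x σ τ i j) {e : ℕ → ℕ → ℕ}
    (he1 : ∀ b c, b < (x : ℕ) + 1 → (x : ℕ) + 1 < c → e b (x + 1) + e (x + 1) c = e b c)
    (he2 : ∀ b c, b < (x : ℕ) + 1 → (x : ℕ) + 1 < c → e c (x + 1) + e (x + 1) b = e c b)
    (hv : v ≠ x) : stepSum e τ (pos τ v) = stepSum e σ (pos σ v) := by
  obtain ⟨a, b, c⟩ := h.stepSum_eq he1 he2
  rcases lt_or_gt_of_ne (h.pos_ne hv) with hlt | hgt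
  · rw [h.pos_of_lt hlt, a _ hlt]
  · rcases le_or_gt (pos σ v) j with hle | hj
    · rw [h.pos_of_mem hgt hle, b _ (by omega) (by omega), Nat.sub_add_cancel (by omega)]
    · rw [h.pos_of_gt hj, c _ hj]

/-- Maximality of the block determines `j`: all letters up to `j` are larger than `x + 1` and the
next one is smaller. With `source_unique`, this makes hopping a bijection. -/
lemma target_unique (h : Hop x σ τ i j) (h' : Hop x σ τ' i' j') : τ = τ' := by
  obtain rfl : i = i' := h.pos_source.symm.trans h'.pos_source
  obtain rfl : j = j' := by
    rcases lt_trichotomy j j' with hlt | heq | hlt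
    · have := h'.above (j + 1) (by have := h.lt; omega) hlt
      have := h.right
      omega
    · exact heq
    · have := h.above (j' + 1) (by have := h'.lt; omega) hlt
      have := h'.right
      omega
  exact perm_ext_of_letter fun k => by rw [h.eq, h'.eq]

lemma source_unique (h : Hop x σ τ i j) (h' : Hop x σ' τ i' j') : σ = σ' := by
  obtain rfl : j = j' := h.pos_end.symm.trans h'.pos_end
  obtain rfl : i = i' := by
    rcases lt_trichotomy i i' with hlt | heq | hlt
    · have := h.target_above (k := i' - 1) (by omega) (by have := h'.lt; omega)
      have := h'.target_left
      omega
    · exact heq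
    · have := h'.target_above (k := i - 1) (by omega) (by have := h.lt; omega)
      have := h.target_left
      omega
  exact perm_ext_of_letter fun k => by
    rw [← rotate_unrotate h.lt k, ← h.eq, ← h'.eq]

end Hop

/-! ### The statistics as sums over letters -/

/-- The indicator of a descent from `b` to `c` across the level `l`. -/
def downCross (l b c : ℕ) : ℕ := if c < l ∧ l < b then 1 else 0

/-- The indicator of an ascent from `b` to `c` across the level `l`. -/
def upCross (l b c : ℕ) : ℕ := if b < l ∧ l < c then 1 else 0

lemma sum_pos {M : Type*} [AddCommMonoid M] (σ : Equiv.Perm (Fin N)) (g : ℕ → M) :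
    ∑ k ∈ Icc 1 N, g k = ∑ v, g (pos σ v) := by
  symm
  refine sum_bij (fun v _ => pos σ v) (fun v _ => mem_Icc.2 ⟨one_le_pos σ v, pos_le σ v⟩)
    (fun v _ w _ h => pos_injective σ h) (fun k hk => ?_) fun _ _ => rfl
  obtain ⟨h1, h2⟩ := mem_Icc.1 hk
  obtain ⟨v, hv⟩ := exists_pos_eq σ h1 h2
  exact ⟨v, mem_univ _, hv⟩

lemma card_filter_pos (σ : Equiv.Perm (Fin N)) (P : ℕ → Prop) [DecidablePred P] :
    #{k ∈ Icc 1 N | P k} = #{v | P (pos σ v)} := by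
  rw [card_filter, card_filter, sum_pos σ]

/-- For a fixed letter `σ_j`, the admissible `i` are the falling steps before `j` that cross its
level, so `les` becomes a sum of step sums. -/
lemma les_eq_sum (σ : Equiv.Perm (Fin N)) :
    les σ = ∑ v : Fin N, stepSum (downCross (v + 1)) σ (pos σ v) := by
  have key : ∀ J ∈ Icc 1 N, stepSum (downCross (letter σ J)) σ J =
      ∑ I ∈ Icc 2 N, if I < J ∧ letter σ (I - 1) > letter σ J ∧ letter σ J > letter σ I
        then 1 else 0 := by
    intro J hJ
    obtain ⟨hJ1, hJN⟩ := mem_Icc.1 hJ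
    simp only [stepSum, downCross]
    rw [← card_filter, ← card_filter]
    refine card_bij (fun m _ => m + 1) (fun m hm => ?_) (fun m _ m' _ h => by omega) fun I hI => ?_
    · simp only [mem_filter, mem_range, mem_Icc, Nat.add_sub_cancel] at hm ⊢
      obtain ⟨h1, h2, h3⟩ := hm
      -- The step out of `σ_0 = 0` cannot fall, and the step into position `J` ends on the level
      -- without crossing it.
      have : m ≠ 0 := by rintro rfl; rw [letter_zero] at h3; omega
      have : m + 1 ≠ J := by rintro rfl; omega
      omega
    · simp only [mem_filter, mem_range, mem_Icc] at hI ⊢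
      obtain ⟨⟨h1, h2⟩, h3, h4, h5⟩ := hI
      have : I - 1 + 1 = I := by omega
      exact ⟨I - 1, ⟨by omega, by rw [this]; exact ⟨h5, h4⟩⟩, this⟩
  calc les σ = ∑ J ∈ Icc 2 N, ∑ I ∈ Icc 2 N,
        if I < J ∧ letter σ (I - 1) > letter σ J ∧ letter σ J > letter σ I then 1 else 0 := by
        rw [les, card_filter, sum_product_right]
    _ = ∑ J ∈ Icc 1 N, ∑ I ∈ Icc 2 N,
        if I < J ∧ letter σ (I - 1) > letter σ J ∧ letter σ J > letter σ I then 1 else 0 := by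
        refine sum_subset (Icc_subset_Icc_left (by omega)) fun J hJ hJ' => ?_
        simp only [mem_Icc] at hJ hJ'
        exact sum_eq_zero fun I hI => if_neg fun h => by
          have := mem_Icc.1 hI
          omega
    _ = ∑ J ∈ Icc 1 N, stepSum (downCross (letter σ J)) σ J :=
        sum_congr rfl fun J hJ => (key J hJ).symm
    _ = _ := by
        rw [sum_pos σ]
        simp only [letter_pos]

lemma res_eq_sum (σ : Equiv.Perm (Fin N)) :
    res σ = ∑ v : Fin N, ∑ m ∈ Ico (pos σ v) (N + 1),
      upCross (v + 1) (letter σ m) (letter σ (m + 1)) := by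
  have key : ∀ I ∈ Icc 1 N, ∑ m ∈ Ico I (N + 1),
      upCross (letter σ I) (letter σ m) (letter σ (m + 1)) =
      ∑ J ∈ Ico 1 N, if I < J ∧ letter σ (J + 1) > letter σ I ∧ letter σ I > letter σ J
        then 1 else 0 := by
    intro I hI
    obtain ⟨hI1, hIN⟩ := mem_Icc.1 hI
    simp only [upCross]
    rw [← card_filter, ← card_filter]
    congr 1
    ext m
    simp only [mem_filter, mem_Ico]
    constructor
    · rintro ⟨h1, h2, h3⟩
      -- The extra step into `σ_{N+1} = 0` cannot rise, so including it is harmless.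
      have : m ≠ N := fun he => by
        rw [he, letter_of_lt (k := N + 1) (by omega)] at h3
        omega
      have : m ≠ I := by rintro rfl; omega
      omega
    · rintro ⟨h1, h2, h3, h4⟩
      omega
  calc res σ = ∑ I ∈ Ico 1 N, ∑ J ∈ Ico 1 N,
        if I < J ∧ letter σ (J + 1) > letter σ I ∧ letter σ I > letter σ J then 1 else 0 := by
        rw [res, card_filter, sum_product]
    _ = ∑ I ∈ Icc 1 N, ∑ J ∈ Ico 1 N,
        if I < J ∧ letter σ (J + 1) > letter σ I ∧ letter σ I > letter σ J then 1 else 0 := by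
        refine sum_subset Ico_subset_Icc_self fun I hI hI' => ?_
        simp only [mem_Icc, mem_Ico] at hI hI'
        exact sum_eq_zero fun J hJ => if_neg fun h => by
          have := mem_Ico.1 hJ
          omega
    _ = ∑ I ∈ Icc 1 N, ∑ m ∈ Ico I (N + 1),
          upCross (letter σ I) (letter σ m) (letter σ (m + 1)) :=
        sum_congr rfl fun I hI => (key I hI).symm
    _ = _ := by
        rw [sum_pos σ]
        simp only [letter_pos]

lemma isLeftToRightMax_pos_iff (σ : Equiv.Perm (Fin N)) (v : Fin N) :
    IsLeftToRightMax σ (pos σ v) ↔ ∀ w, pos σ w < pos σ v → w < v := by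
  constructor
  · intro h w hw
    have := h _ (mem_Ico.2 ⟨one_le_pos σ w, hw⟩)
    rw [letter_pos, letter_pos] at this
    exact Fin.lt_def.2 (by omega)
  · intro h k hk
    obtain ⟨h1, h2⟩ := mem_Ico.1 hk
    obtain ⟨w, rfl⟩ := exists_pos_eq σ h1 (by have := pos_le σ v; omega)
    have := Fin.lt_def.1 (h w h2)
    rw [letter_pos, letter_pos]
    omega

lemma lema_eq_card (σ : Equiv.Perm (Fin N)) :
    lema σ = #{v | (∀ w, pos σ w < pos σ v → w < v) ∧ Even ((v : ℕ) + 1)} := by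
  rw [lema, card_filter_pos σ]
  simp only [isLeftToRightMax_pos_iff, letter_pos]

lemma not_risesTo_iff : ¬ RisesTo σ v ↔ letter σ (pos σ v - 1) > v + 1 := by
  have := letter_pred_pos_ne σ v
  unfold RisesTo
  omega

lemma isDoubleDescent_pos_iff :
    IsDoubleDescent σ (pos σ v) ↔ ¬ RisesTo σ v ∧ FallsFrom σ v := by
  rw [not_risesTo_iff, IsDoubleDescent, letter_pos]

lemma dd_eq_card (σ : Equiv.Perm (Fin N)) :
    dd σ = #{v | ¬ RisesTo σ v ∧ FallsFrom σ v} := by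
  rw [dd, card_filter_pos σ]
  simp only [isDoubleDescent_pos_iff]

/-- Descents are counted by their bottoms; the first letter rises from the boundary zero and is
never one. -/
lemma des_eq_card_not_risesTo (σ : Equiv.Perm (Fin N)) : des σ = #{v | ¬ RisesTo σ v} := by
  simp only [not_risesTo_iff]
  have := card_filter_pos σ fun k => letter σ (k - 1) > letter σ k
  simp only [letter_pos] at this
  rw [← this, des]
  refine card_bij (fun m _ => m + 1) (fun m hm => ?_) (fun m _ m' _ h => by omega) fun k hk => ?_
  · simp only [mem_filter, mem_Ico, mem_Icc, Nat.add_sub_cancel, IsDescent] at hm ⊢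
    omega
  · simp only [mem_filter, mem_Ico, mem_Icc, IsDescent] at hk ⊢
    obtain ⟨⟨h1, h2⟩, h3⟩ := hk
    have : k ≠ 1 := by
      rintro rfl
      rw [Nat.sub_self, letter_zero] at h3
      omega
    have hk' : k - 1 + 1 = k := by omega
    exact ⟨k - 1, ⟨by omega, by rwa [hk']⟩, hk'⟩

/-- Besides the descent tops, the last letter falls to the boundary zero. -/
lemma card_fallsFrom (σ : Equiv.Perm (Fin N)) (hN : 1 ≤ N) : #{v | FallsFrom σ v} = des σ + 1 := by
  have := card_filter_pos σ fun k => letter σ (k + 1) < letter σ k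
  simp only [letter_pos] at this
  have hlast : letter σ (N + 1) < letter σ N := by
    obtain ⟨v, hv⟩ := exists_pos_eq σ hN le_rfl
    have := letter_pos σ v
    rw [hv] at this
    rw [letter_of_lt (k := N + 1) (by omega)]
    omega
  rw [← this, des, ← Ico_insert_right hN, filter_insert, if_pos hlast,
    card_insert_of_notMem (by simp)]

lemma des_eq_add_dd (σ : Equiv.Perm (Fin N)) :
    des σ = #{v | ¬ RisesTo σ v ∧ ¬ FallsFrom σ v} + dd σ := by
  rw [des_eq_card_not_risesTo, dd_eq_card, add_comm, ← filter_filter, ← filter_filter,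
    card_filter_add_card_filter_not]

/-! ### Invariance of the statistics under hops -/

namespace Hop

lemma les_eq (h : Hop x σ τ i j) : les τ = les σ := by
  rw [les_eq_sum, les_eq_sum]
  refine sum_congr rfl fun v _ => ?_
  by_cases hv : v = x
  · subst hv
    rw [h.pos_source, h.pos_end]
    have h1 := h.one_le
    -- For the moved letter itself: from position `i` to `j` the word of `τ` stays at or above its
    -- level, so no falling step crosses it.
    have key : ∀ k, i - 1 ≤ k → k ≤ j →
        stepSum (downCross (v + 1)) τ k = stepSum (downCross (v + 1)) σ (i - 1) := by
      intro k hk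
      induction k, hk using Nat.le_induction with
      | base =>
        intro _
        refine sum_congr rfl fun m hm => ?_
        have := mem_range.1 hm
        rw [h.letter_of_lt (by omega), h.letter_of_lt (by omega)]
      | succ k hk ih =>
        intro hkj
        rw [stepSum_succ, ih (by omega), downCross, if_neg, add_zero]
        rcases hkj.lt_or_eq with hlt | heq
        · have := h.target_above (k := k + 1) (by omega) hlt
          omega
        · rw [heq, h.letter_end]; omega
    rw [key j (by have := h.lt; omega) le_rfl]
    obtain ⟨i, rfl⟩ : ∃ i', i = i' + 1 := ⟨i - 1, by omega⟩
    rw [stepSum_succ, h.start, Nat.add_sub_cancel, downCross, if_neg (by omega), add_zero]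
  · have hne : (v : ℕ) ≠ x := fun hvx => hv (Fin.ext hvx)
    refine h.stepSum_pos_eq (fun b c hb hc => ?_) (fun b c hb hc => ?_) hv <;>
    · unfold downCross
      split_ifs <;> omega

lemma res_eq (h : Hop x σ τ i j) : res τ = res σ := by
  rw [res_eq_sum, res_eq_sum]
  refine sum_congr rfl fun v _ => ?_
  by_cases hv : v = x
  · subst hv
    have hlt := h.lt
    have hle := h.le
    rw [h.pos_source, h.pos_end,
      ← sum_Ico_consecutive _ (show i ≤ j + 1 by omega) (show j + 1 ≤ N + 1 by omega),
      ← sum_Ico_consecutive _ (show j ≤ j + 1 by omega) (show j + 1 ≤ N + 1 by omega)]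
    congr 1
    · rw [sum_eq_zero, sum_eq_zero]
      · intro m hm
        have := mem_Ico.1 hm
        refine if_neg ?_
        rcases this.1.lt_or_eq with hl | he
        · have := h.above m hl (by omega)
          omega
        · rw [← he, h.start]; omega
      · intro m hm
        have := mem_Ico.1 hm
        obtain rfl : m = j := by omega
        refine if_neg ?_
        rw [h.letter_end]; omega
    · refine sum_congr rfl fun m hm => ?_
      have := mem_Ico.1 hm
      rw [h.letter_of_gt (by omega), h.letter_of_gt (by omega)]
  · have hne : (v : ℕ) ≠ x := fun hvx => hv (Fin.ext hvx)
    have he1 : ∀ b c, b < (x : ℕ) + 1 → (x : ℕ) + 1 < c →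
        upCross (v + 1) b (x + 1) + upCross (v + 1) (x + 1) c = upCross (v + 1) b c := by
      intro b c hb hc
      unfold upCross
      split_ifs <;> omega
    have he2 : ∀ b c, b < (x : ℕ) + 1 → (x : ℕ) + 1 < c →
        upCross (v + 1) c (x + 1) + upCross (v + 1) (x + 1) b = upCross (v + 1) c b := by
      intro b c hb hc
      unfold upCross
      split_ifs <;> omega
    have total := (h.stepSum_eq he1 he2).2.2 (N + 1) (by have := h.le; omega)
    have part := h.stepSum_pos_eq he1 he2 hv
    -- Crossings after the letter are all crossings minus those before it, and a hop preserves both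
    -- counts.
    have split : ∀ ρ : Equiv.Perm (Fin N), stepSum (upCross (v + 1)) ρ (pos ρ v) +
        ∑ m ∈ Ico (pos ρ v) (N + 1), upCross (v + 1) (letter ρ m) (letter ρ (m + 1)) =
        stepSum (upCross (v + 1)) ρ (N + 1) := fun ρ =>
      sum_range_add_sum_Ico _ (by have := pos_le ρ v; omega)
    have h1 := split σ
    have h2 := split τ
    omega

/-- The set of letters before `v` changes only if `v` lies in the block, and then only by `x`, which
is smaller than `v`. -/
lemma forall_lt_iff (h : Hop x σ τ i j) (hv : v ≠ x) :
    (∀ w, pos τ w < pos τ v → w < v) ↔ ∀ w, pos σ w < pos σ v → w < v := by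
  have hne := h.pos_ne hv
  have hlt := h.lt
  have above : i < pos σ v → pos σ v ≤ j → x < v := fun h1 h2 => by
    have := h.above _ h1 h2
    rw [letter_pos] at this
    exact Fin.lt_def.2 (by omega)
  refine forall_congr' fun w => ?_
  by_cases hw : w = x
  · subst hw
    rw [h.pos_end, h.pos_source, h.pos_target v, unrotate]
    by_cases hm : i < pos σ v ∧ pos σ v ≤ j
    · have := above hm.1 hm.2
      simp [this]
    · split_ifs
      · rw [show (j < pos σ v) = (i < pos σ v) from propext (by omega)]
      · omega
  · have hnw := h.pos_ne hw
    rw [h.pos_target v, h.pos_target w]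
    refine imp_congr_left ?_
    unfold unrotate
    split_ifs <;> omega

lemma lema_eq (h : Hop x σ τ i j) (hx : Odd ((x : ℕ) + 1)) : lema τ = lema σ := by
  rw [lema_eq_card, lema_eq_card]
  congr 1
  refine filter_congr fun v _ => ?_
  by_cases hv : v = x
  · subst hv
    simp [Nat.not_even_iff_odd.2 hx]
  · rw [h.forall_lt_iff hv]

/-- The moved letter is a double ascent before and a double descent after, hence never a valley. -/
lemma card_valleys_eq (h : Hop x σ τ i j) :
    #{v | ¬ RisesTo τ v ∧ ¬ FallsFrom τ v} = #{v | ¬ RisesTo σ v ∧ ¬ FallsFrom σ v} := by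
  congr 1
  refine filter_congr fun v _ => ?_
  by_cases hv : v = x
  · subst hv
    simp [h.risesTo_source, h.fallsFrom_target]
  · rw [h.risesTo_iff hv, h.fallsFrom_iff hv]

end Hop

end Words

/-! ### Local description of `Ystar` and `FPerm` -/

section Expansion

variable {n : ℕ}

/-- An even letter can be neither bottom nor top of a descent; the odd last letter excludes the fall
of an even letter to the boundary zero. The conditions thus become local to each letter, as hopping
needs. -/
lemma mem_Ystar_iff {σ : Equiv.Perm (Fin (2 * n + 1))} :
    σ ∈ Ystar n ↔ ∀ v : Fin (2 * n + 1), Even ((v : ℕ) + 1) → RisesTo σ v ∧ ¬ FallsFrom σ v := by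
  simp only [Ystar, mem_filter, mem_univ, true_and]
  constructor
  · rintro ⟨h, hlast⟩ v hv
    have h1 := one_le_pos σ v
    have h2 := pos_le σ v
    have hp := letter_pos σ v
    rw [← Nat.not_odd_iff_even] at hv
    constructor
    · by_contra hr
      rw [not_risesTo_iff] at hr
      have hne : pos σ v ≠ 1 := by
        intro he
        rw [he, Nat.sub_self, letter_zero] at hr
        omega
      have hs : pos σ v - 1 + 1 = pos σ v := by omega
      have := (h (pos σ v - 1) (mem_Ico.2 (by omega)) (by rw [IsDescent, hs]; omega)).2
      rw [hs, hp] at this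
      exact hv this
    · intro hf
      rcases h2.lt_or_eq with hlt | heq
      · have := (h (pos σ v) (mem_Ico.2 ⟨h1, hlt⟩) (by rw [IsDescent, hp]; exact hf)).1
        rw [hp] at this
        exact hv this
      · rw [heq] at hp
        rw [hp] at hlast
        exact hv hlast
  · intro h
    have fall : ∀ i, 1 ≤ i → i ≤ 2 * n + 1 → letter σ (i + 1) < letter σ i →
        Odd (letter σ i) := by
      intro i h1 h2 h3
      obtain ⟨v, rfl⟩ := exists_pos_eq σ h1 h2
      rw [letter_pos] at h3 ⊢
      by_contra hv
      exact (h v (Nat.not_odd_iff_even.1 hv)).2 h3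
    refine ⟨fun i hi hd => ?_, fall _ (by omega) le_rfl ?_⟩
    · obtain ⟨h1, h2⟩ := mem_Ico.1 hi
      refine ⟨fall i h1 (by omega) hd, ?_⟩
      obtain ⟨v, hv⟩ := exists_pos_eq σ (show 1 ≤ i + 1 by omega) (by omega)
      have hp := letter_pos σ v
      rw [hv] at hp
      rw [IsDescent, hp] at hd
      rw [hp]
      by_contra hodd
      have := (h v (Nat.not_odd_iff_even.1 hodd)).1
      rw [RisesTo, hv, Nat.add_sub_cancel] at this
      omega
    · obtain ⟨v, hv⟩ := exists_pos_eq σ (show 1 ≤ 2 * n + 1 by omega) le_rfl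
      have := letter_pos σ v
      rw [hv] at this
      rw [letter_of_lt (k := 2 * n + 1 + 1) (by omega)]
      omega

lemma Hop.mem_Ystar_iff {σ τ : Equiv.Perm (Fin (2 * n + 1))} {x : Fin (2 * n + 1)} {i j : ℕ}
    (h : Hop x σ τ i j) (hx : Odd ((x : ℕ) + 1)) : τ ∈ Ystar n ↔ σ ∈ Ystar n := by
  rw [OddOdd.mem_Ystar_iff, OddOdd.mem_Ystar_iff]
  refine forall_congr' fun v => ?_
  by_cases hv : v = x
  · subst hv
    simp [Nat.not_even_iff_odd.2 hx]
  · rw [h.risesTo_iff hv, h.fallsFrom_iff hv]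

/-- The peak condition is redundant: the last letter falls to the boundary zero, so it must rise if
it is no double descent. -/
lemma mem_FPerm_iff {σ : Equiv.Perm (Fin (2 * n + 1))} :
    σ ∈ FPerm n ↔ σ ∈ Ystar n ∧ ∀ v, ¬ (¬ RisesTo σ v ∧ FallsFrom σ v) := by
  simp only [FPerm, mem_filter]
  refine and_congr_right fun _ => ?_
  constructor
  · rintro ⟨h, -⟩ v hv
    exact h _ (mem_Icc.2 ⟨one_le_pos σ v, pos_le σ v⟩) (isDoubleDescent_pos_iff.2 hv)
  · intro h
    refine ⟨fun i hi hd => ?_, ?_⟩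
    · obtain ⟨h1, h2⟩ := mem_Icc.1 hi
      obtain ⟨v, rfl⟩ := exists_pos_eq σ h1 h2
      exact h v (isDoubleDescent_pos_iff.1 hd)
    · obtain ⟨v, hv⟩ := exists_pos_eq σ (show 1 ≤ 2 * n + 1 by omega) le_rfl
      have hf : FallsFrom σ v := by
        rw [FallsFrom, hv, letter_of_lt (by omega)]
        omega
      have hr : RisesTo σ v := by
        by_contra hr
        exact h v ⟨hr, hf⟩
      have hpeak : IsPeak σ (pos σ v) := by
        rw [IsPeak, letter_pos]
        exact ⟨hr, hf⟩
      rwa [hv] at hpeak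

lemma card_odd_letters (n : ℕ) : #{v : Fin (2 * n + 1) | Odd ((v : ℕ) + 1)} = n + 1 := by
  rw [card_filter, Fin.sum_univ_eq_sum_range (fun k => if Odd (k + 1) then 1 else 0)]
  induction n with
  | zero => decide
  | succ n ih =>
    rw [show 2 * (n + 1) + 1 = 2 * n + 1 + 1 + 1 by ring, sum_range_succ, sum_range_succ, ih,
      if_neg (by simp [Nat.odd_iff]; omega), if_pos (by simp [Nat.odd_iff]; omega)]

/-- The letter `v + 1` is an odd double ascent. -/
abbrev IsOddDoubleAscent {N : ℕ} (σ : Equiv.Perm (Fin N)) (v : Fin N) : Prop :=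
  Odd ((v : ℕ) + 1) ∧ RisesTo σ v ∧ ¬ FallsFrom σ v

/-- All peaks and valleys are odd here. Among the `n + 1` odd letters, `des σ + 1` are peaks, `des
σ` are valleys, and the rest are double ascents. -/
lemma two_mul_des_add_card {σ : Equiv.Perm (Fin (2 * n + 1))} (h : σ ∈ FPerm n) :
    2 * des σ + #{v | IsOddDoubleAscent σ v} = n := by
  obtain ⟨hY, hdd⟩ := mem_FPerm_iff.1 h
  rw [mem_Ystar_iff] at hY
  have h1 := card_odd_letters n
  have h2 := card_fallsFrom σ (by omega)
  have h3 := des_eq_card_not_risesTo σ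
  have key : #{v : Fin (2 * n + 1) | Odd ((v : ℕ) + 1)} =
      #{v | FallsFrom σ v} + #{v | ¬ RisesTo σ v} + #{v | IsOddDoubleAscent σ v} := by
    simp only [card_filter]
    rw [← sum_add_distrib, ← sum_add_distrib]
    refine sum_congr rfl fun v _ => ?_
    have a := hY v
    have b := hdd v
    rw [← Nat.not_odd_iff_even] at a
    by_cases ho : Odd ((v : ℕ) + 1) <;> by_cases hr : RisesTo σ v <;>
      by_cases hf : FallsFrom σ v <;> first
      | (exfalso; tauto)
      | simp only [IsOddDoubleAscent, ho, hr, hf, not_true_eq_false, not_false_eq_true, and_true,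
          and_false, and_self, if_true, if_false]
  omega

/-! ### Trading double descents for factors `1 + y * t` -/

variable {R : Type*} [CommRing R]

/-- The factor of the letter `v + 1` in the weight in which the double descents of the letters
of `S` have been traded for a factor `1 + y * t` of their odd double ascents. -/
def letterFactor (y t : R) {N : ℕ} (S : Finset (Fin N)) (σ : Equiv.Perm (Fin N)) (v : Fin N) : R :=
  if v ∈ S then if IsOddDoubleAscent σ v then 1 + y * t else 1
  else if ¬ RisesTo σ v ∧ FallsFrom σ v then y * t else 1

/-- The part of the weight that is invariant under hops. -/
def hopWeight (a p q t : R) {N : ℕ} (σ : Equiv.Perm (Fin N)) : R :=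
  a ^ lema σ * p ^ res σ * q ^ les σ * t ^ #{v | ¬ RisesTo σ v ∧ ¬ FallsFrom σ v}

/-- The elements of `𝒴*_{2n+1}` in which no letter of `S` is a double descent. -/
def YstarAvoid (n : ℕ) (S : Finset (Fin (2 * n + 1))) : Finset (Equiv.Perm (Fin (2 * n + 1))) :=
  {σ ∈ Ystar n | ∀ v ∈ S, ¬ (¬ RisesTo σ v ∧ FallsFrom σ v)}

/-- Hopping exchanges the double descents and the double ascents of an odd letter. -/
lemma sum_doubleDescent_eq_sum_doubleAscent {S : Finset (Fin (2 * n + 1))} {x : Fin (2 * n + 1)}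
    (hxS : x ∉ S) (hx : Odd ((x : ℕ) + 1)) (G : Equiv.Perm (Fin (2 * n + 1)) → R)
    (hG : ∀ σ τ i j, Hop x σ τ i j → G τ = G σ) :
    ∑ σ ∈ YstarAvoid n S with (¬ RisesTo σ x ∧ FallsFrom σ x), G σ =
      ∑ σ ∈ YstarAvoid n S with IsOddDoubleAscent σ x, G σ := by
  have mem : ∀ σ τ i j, Hop x σ τ i j → (τ ∈ YstarAvoid n S ↔ σ ∈ YstarAvoid n S) := by
    intro σ τ i j h
    simp only [YstarAvoid, mem_filter]
    rw [h.mem_Ystar_iff hx]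
    refine and_congr_right fun _ => forall₂_congr fun v hv => ?_
    have hvx : v ≠ x := fun he => hxS (he ▸ hv)
    rw [h.risesTo_iff hvx, h.fallsFrom_iff hvx]
  symm
  -- The hop is merely chosen; its uniqueness from either end gives injectivity and surjectivity.
  have ex : ∀ σ ∈ YstarAvoid n S |>.filter (IsOddDoubleAscent · x), ∃ τ i j, Hop x σ τ i j :=
    fun σ hσ => exists_hop_of_doubleAscent (mem_filter.1 hσ).2.2.1 (mem_filter.1 hσ).2.2.2
  choose φ i j hφ using ex
  refine sum_bij φ (fun σ hσ => ?_) (fun σ hσ σ' hσ' he => ?_) (fun τ hτ => ?_)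
    fun σ hσ => (hG _ _ _ _ (hφ σ hσ)).symm
  · have h := hφ σ hσ
    exact mem_filter.2 ⟨(mem _ _ _ _ h).2 (mem_filter.1 hσ).1, h.not_risesTo_target,
      h.fallsFrom_target⟩
  · have h := hφ σ hσ
    rw [he] at h
    exact h.source_unique (hφ σ' hσ')
  · obtain ⟨hτ1, hτ2, hτ3⟩ := mem_filter.1 hτ
    obtain ⟨σ, i, j, h⟩ := exists_hop_of_doubleDescent hτ2 hτ3
    have hσ : σ ∈ (YstarAvoid n S).filter (IsOddDoubleAscent · x) :=
      mem_filter.2 ⟨(mem _ _ _ _ h).1 hτ1, hx, h.risesTo_source, h.not_fallsFrom_source⟩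
    exact ⟨σ, hσ, (hφ σ hσ).target_unique h⟩

/-- Split by whether `x` is a double descent. Those words carry `y * t` and are hopped onto the
words where `x` is an odd double ascent, so that `1` becomes `1 + y * t` there. -/
lemma sum_YstarAvoid_insert {S : Finset (Fin (2 * n + 1))} {x : Fin (2 * n + 1)}
    (hxS : x ∉ S) (a p q y t : R) :
    ∑ σ ∈ YstarAvoid n S, hopWeight a p q t σ * ∏ v, letterFactor y t S σ v =
      ∑ σ ∈ YstarAvoid n (insert x S),
        hopWeight a p q t σ * ∏ v, letterFactor y t (insert x S) σ v := by
  -- The weight without the factor of `x`, which is invariant under hops of an odd `x`.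
  set G : Equiv.Perm (Fin (2 * n + 1)) → R := fun σ =>
    hopWeight a p q t σ * ∏ v ∈ univ.erase x, letterFactor y t S σ v with hGdef
  have e1 : ∀ σ, hopWeight a p q t σ * ∏ v, letterFactor y t S σ v =
      G σ * if ¬ RisesTo σ x ∧ FallsFrom σ x then y * t else 1 := fun σ => by
    rw [← prod_erase_mul _ _ (mem_univ x), ← mul_assoc]
    congr 1
    rw [letterFactor, if_neg hxS]
  have e2 : ∀ σ, hopWeight a p q t σ * ∏ v, letterFactor y t (insert x S) σ v =
      G σ * if IsOddDoubleAscent σ x then 1 + y * t else 1 := fun σ => by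
    rw [← prod_erase_mul _ _ (mem_univ x), ← mul_assoc]
    congr 1
    · rw [hGdef]
      congr 1
      refine prod_congr rfl fun v hv => ?_
      have hvx := (mem_erase.1 hv).1
      simp only [letterFactor, mem_insert, hvx, false_or]
    · rw [letterFactor, if_pos (mem_insert_self x S)]
  have avoid : YstarAvoid n (insert x S) =
      (YstarAvoid n S).filter fun σ => ¬ (¬ RisesTo σ x ∧ FallsFrom σ x) := by
    ext σ
    simp only [YstarAvoid, mem_filter, forall_mem_insert]
    tauto
  simp only [e1, e2]
  rw [avoid, ← sum_filter_add_sum_filter_not (YstarAvoid n S)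
    fun σ => ¬ RisesTo σ x ∧ FallsFrom σ x]
  have s1 : ∑ σ ∈ YstarAvoid n S with (¬ RisesTo σ x ∧ FallsFrom σ x),
      G σ * (if ¬ RisesTo σ x ∧ FallsFrom σ x then y * t else 1) =
      ∑ σ ∈ YstarAvoid n S with IsOddDoubleAscent σ x, G σ * (y * t) := by
    by_cases hx : Odd ((x : ℕ) + 1)
    · rw [← sum_doubleDescent_eq_sum_doubleAscent hxS hx fun σ => G σ * (y * t)]
      · exact sum_congr rfl fun σ hσ => by rw [if_pos (mem_filter.1 hσ).2]
      · intro σ τ i j h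
        simp only [hGdef, hopWeight]
        rw [h.lema_eq hx, h.res_eq, h.les_eq, h.card_valleys_eq]
        congr 2
        refine prod_congr rfl fun v hv => ?_
        have hvx := (mem_erase.1 hv).1
        simp only [letterFactor, IsOddDoubleAscent, h.risesTo_iff hvx, h.fallsFrom_iff hvx]
    -- An even `x` contributes to neither side, since it is always a double ascent.
    · rw [sum_eq_zero, sum_eq_zero]
      · exact fun σ hσ => absurd (mem_filter.1 hσ).2.1 hx
      · intro σ hσ
        obtain ⟨hY, hr, -⟩ := mem_filter.1 hσ
        exact absurd (mem_Ystar_iff.1 (mem_filter.1 hY).1 x (Nat.not_odd_iff_even.1 hx)).1 hr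
  have s2 : ∑ σ ∈ YstarAvoid n S with IsOddDoubleAscent σ x, G σ * (y * t) =
      ∑ σ ∈ YstarAvoid n S with ¬ (¬ RisesTo σ x ∧ FallsFrom σ x),
        if IsOddDoubleAscent σ x then G σ * (y * t) else 0 := by
    rw [← sum_filter, filter_filter]
    congr 1
    refine filter_congr fun σ _ => ?_
    tauto
  rw [s1, s2, ← sum_add_distrib]
  refine sum_congr rfl fun σ hσ => ?_
  rw [if_neg (mem_filter.1 hσ).2]
  split_ifs <;> ring

/-- This interpolates between `Y` at `S = ∅` and the sum over `FPerm` at `S = univ`. -/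
lemma Y_eq_sum_YstarAvoid (S : Finset (Fin (2 * n + 1))) (a p q y t : R) :
    Y n a p q y t =
      ∑ σ ∈ YstarAvoid n S, hopWeight a p q t σ * ∏ v, letterFactor y t S σ v := by
  induction S using Finset.induction_on with
  | empty =>
    simp only [Y, YstarAvoid, notMem_empty, false_imp_iff, implies_true, filter_true]
    refine sum_congr rfl fun σ _ => ?_
    simp only [letterFactor, notMem_empty, if_false, hopWeight]
    rw [← prod_filter, prod_const, ← dd_eq_card, des_eq_add_dd]
    ring
  | insert x S hx ih => rw [ih, sum_YstarAvoid_insert hx]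

lemma Y_eq_sum_FPerm (a p q y t : R) :
    Y n a p q y t = ∑ σ ∈ FPerm n,
      a ^ lema σ * p ^ res σ * q ^ les σ * t ^ des σ * (1 + y * t) ^ (n - 2 * des σ) := by
  rw [Y_eq_sum_YstarAvoid univ]
  refine sum_congr (by ext σ; simp [YstarAvoid, mem_FPerm_iff]) fun σ hσ => ?_
  have hdd : dd σ = 0 := by
    rw [dd_eq_card, card_eq_zero, filter_eq_empty_iff]
    exact fun v _ => (mem_FPerm_iff.1 hσ).2 v
  have hcard := two_mul_des_add_card hσ
  have hdes := des_eq_add_dd σ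
  rw [hdd, add_zero] at hdes
  simp only [letterFactor, mem_univ, if_true, hopWeight]
  rw [← prod_filter, prod_const, ← hdes, show n - 2 * des σ = #{v | IsOddDoubleAscent σ v} by omega]

end Expansion

end OddOdd

theorem mainTheorem6 {R : Type*} [CommRing R] (n : ℕ) (a p q y t : R) :
    OddOdd.Y n a p q y t =
      ∑ k ∈ Finset.range (n / 2 + 1),
        OddOdd.gammaCoeff n k a p q * t ^ k * (1 + y * t) ^ (n - 2 * k) := by
  rw [OddOdd.Y_eq_sum_FPerm, ← Finset.sum_fiberwise_of_maps_to (g := OddOdd.des)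
    (t := Finset.range (n / 2 + 1))]
  · refine Finset.sum_congr rfl fun k _ => ?_
    rw [OddOdd.gammaCoeff, Finset.sum_mul, Finset.sum_mul]
    refine Finset.sum_congr rfl fun σ hσ => ?_
    rw [(Finset.mem_filter.1 hσ).2]
  · intro σ hσ
    have := OddOdd.two_mul_des_add_card hσ
    rw [Finset.mem_range]
    omega
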